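/- Let $\mathcal X$ be a set with a symmetric neighbor relation $\mathcal N\subseteq\mathcal X^2$, let $\mathcal Z$ be a measurable space, and let $P_{Z|X}$ be a mechanism, i.e. a family of probability distributions $P_{Z|X}(\cdot\,|\,x)$, $x\in\mathcal X$, on $\mathcal Z$. For $\varepsilon,\delta\in\mathbb R$, a mechanism $P_{Y|X}$ from $\mathcal X$ to a measurable space $\mathcal Y$ is called $(\varepsilon,\delta)$-differentially private (DP) if $$P_{Y|X}(\mathcal S\,|\,x)\le e^{\varepsilon}P_{Y|X}(\mathcal S\,|\,x')+\delta\qquad\text{for all }(x,x')\in\mathcal N\text{ and all measurable }\mathcal S\subseteq\mathcal Y.$$ Let $Q$ be a probability distribution on $\mathcal Z$ with $P_{Z|X}(\cdot\,|\,x)\ll Q$ for every $x\in\mathcal X$, and let $1<\alpha<\infty$. The Poisson private representation (PPR) of $P_{Z|X}$ with parameter $\alpha$ and proposal distribution $Q$ is the mechanism $P_{(Z_i)_i,K|X}$ from $\mathcal X$ to $\mathcal Z^{\infty}\times\mathbb Z_{+}$ that on input $x$ outputs $((Z_i)_{i\ge1},K)$, where $Z_1,Z_2,\ldots$ are i.i.d.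 with distribution $Q$; $T_1<T_2<\cdots$ are the points of a Poisson process of rate $1$ (i.e. $T_1,T_2-T_1,T_3-T_2,\ldots$ are i.i.d. $\mathrm{Exp}(1)$) independent of $(Z_i)_i$; with $P=P_{Z|X}(\cdot\,|\,x)$, $$\tilde T_i=T_i\cdot\Big(\frac{\mathrm dP}{\mathrm dQ}(Z_i)\Big)^{-1}\qquad\Big(\tilde T_i=\infty\text{ if }\frac{\mathrm dP}{\mathrm dQ}(Z_i)=0\Big);$$ and, conditionally on $(Z_i,T_i)_i$, the index $K\in\mathbb Z_+$ is drawn with $$\Pr\big(K=k\,\big|\,(Z_i,T_i)_i\big)=\frac{\tilde T_k^{-\alpha}}{\sum_{i=1}^{\infty}\tilde T_i^{-\alpha}}.$$ **Theorem.** Let $\varepsilon\ge0$ and $\delta\in\mathbb R$. If the mechanism $P_{Z|X}$ is $(\varepsilon,\delta)$-DP, then the PPR $P_{(Z_i)_i,K|X}$ of $P_{Z|X}$ with parameter $\alpha$ and proposal distribution $Q$ is $(2\alpha\varepsilon,2\delta)$-DP (with respect to the same neighbor relation $\mathcal N$). -/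

import Mathlib

open MeasureTheory ProbabilityTheory
open scoped ENNReal

noncomputable section

/-- A mechanism `M`, given by the conditional law `M x` of its output for each input `x`, is
`(ε, δ)`-differentially private for the neighbor relation `N`. -/
def IsDP {𝒳 𝒴 : Type*} [MeasurableSpace 𝒴] (N : 𝒳 → 𝒳 → Prop) (M : 𝒳 → Measure 𝒴)
    (ε δ : ℝ) : Prop :=
  ∀ x x' : 𝒳, N x x' → ∀ S : Set 𝒴, MeasurableSet S →
    (M x).real S ≤ Real.exp ε * (M x').real S + δ

namespace PPR

/-! Sequences `(a₁, a₂, …)` are indexed by `ℕ`, so that the index `i : ℕ` stands for the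
`(i + 1)`-st entry. -/

instance : IsProbabilityMeasure (expMeasure 1) := isProbabilityMeasure_expMeasure one_pos

/-- Partial sums: the arrival times that belong to a sequence of inter-arrival times. -/
def arrivalTimes (e : ℕ → ℝ) (i : ℕ) : ℝ := ∑ j ∈ Finset.range (i + 1), e j

lemma measurable_arrivalTimes : Measurable arrivalTimes := by
  unfold arrivalTimes
  fun_prop

/-- The law of the arrival times `T₁ < T₂ < ⋯` of a Poisson process of rate `1`: the increments
`T₁, T₂ - T₁, T₃ - T₂, …` are i.i.d. exponential with parameter `1`. -/
def poissonProcess : Measure (ℕ → ℝ) :=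
  (Measure.infinitePi fun _ : ℕ => expMeasure 1).map arrivalTimes

instance : IsProbabilityMeasure poissonProcess :=
  Measure.isProbabilityMeasure_map measurable_arrivalTimes.aemeasurable

variable {𝒵 : Type*} [MeasurableSpace 𝒵]

/-- `T̃ᵢ = Tᵢ · (dP/dQ (Zᵢ))⁻¹`, computed in `[0, ∞]`; it is `∞` when `Tᵢ > 0` and
`dP/dQ (Zᵢ) = 0`. -/
def scaledTime (Q P : Measure 𝒵) (z : ℕ → 𝒵) (t : ℕ → ℝ) (i : ℕ) : ℝ≥0∞ :=
  ENNReal.ofReal (t i) / P.rnDeriv Q (z i)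

/-- `T̃ᵢ ^ (-α)`, with `∞ ^ (-α) = 0`. -/
def weight (α : ℝ) (Q P : Measure 𝒵) (z : ℕ → 𝒵) (t : ℕ → ℝ) (i : ℕ) : ℝ≥0∞ :=
  scaledTime Q P z t i ^ (-α)

/-- The conditional probability `T̃ₖ ^ (-α) / ∑ᵢ T̃ᵢ ^ (-α)` of `K = k` given `(Zᵢ)ᵢ = z` and
`(Tᵢ)ᵢ = t`. For `α > 1` and `P ≪ Q` the sum is almost surely positive and finite; on the
exceptional null event, where the quotient is not a probability vector, `K` is the first index. -/
def indexProb (α : ℝ) (Q P : Measure 𝒵) (z : ℕ → 𝒵) (t : ℕ → ℝ) (k : ℕ) : ℝ≥0∞ :=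
  if (∑' i, weight α Q P z t i) = 0 ∨ (∑' i, weight α Q P z t i) = ∞ then
    (if k = 0 then 1 else 0)
  else weight α Q P z t k / ∑' i, weight α Q P z t i

lemma measurable_weight (α : ℝ) (Q P : Measure 𝒵) (i : ℕ) :
    Measurable fun ω : (ℕ → 𝒵) × (ℕ → ℝ) => weight α Q P ω.1 ω.2 i := by
  have h1 : Measurable fun ω : (ℕ → 𝒵) × (ℕ → ℝ) => P.rnDeriv Q (ω.1 i) :=
    (Measure.measurable_rnDeriv P Q).comp ((measurable_pi_apply i).comp measurable_fst)
  have h2 : Measurable fun ω : (ℕ → 𝒵) × (ℕ → ℝ) => ENNReal.ofReal (ω.2 i) :=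
    ENNReal.measurable_ofReal.comp ((measurable_pi_apply i).comp measurable_snd)
  exact (h2.div h1).pow_const (-α)

lemma measurable_indexProb (α : ℝ) (Q P : Measure 𝒵) (k : ℕ) :
    Measurable fun ω : (ℕ → 𝒵) × (ℕ → ℝ) => indexProb α Q P ω.1 ω.2 k := by
  have hs : Measurable fun ω : (ℕ → 𝒵) × (ℕ → ℝ) => ∑' i, weight α Q P ω.1 ω.2 i :=
    Measurable.tsum fun i => measurable_weight α Q P i
  unfold indexProb
  refine Measurable.ite ?_ measurable_const ((measurable_weight α Q P k).div hs)
  exact (hs (measurableSet_singleton 0)).union (hs (measurableSet_singleton ∞))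

lemma tsum_indexProb (α : ℝ) (Q P : Measure 𝒵) (z : ℕ → 𝒵) (t : ℕ → ℝ) :
    ∑' k, indexProb α Q P z t k = 1 := by
  by_cases h : (∑' i, weight α Q P z t i) = 0 ∨ (∑' i, weight α Q P z t i) = ∞
  · simp only [indexProb, if_pos h]
    exact tsum_ite_eq 0 _
  · simp only [indexProb, if_neg h]
    rw [not_or] at h
    simp only [div_eq_mul_inv]
    rw [ENNReal.tsum_mul_right]
    exact ENNReal.mul_inv_cancel h.1 h.2

/-- The conditional law of the index `K` given `((Zᵢ)ᵢ, (Tᵢ)ᵢ)`. -/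
def indexKernel (α : ℝ) (Q P : Measure 𝒵) : Kernel ((ℕ → 𝒵) × (ℕ → ℝ)) ℕ where
  toFun ω := Measure.sum fun k => indexProb α Q P ω.1 ω.2 k • Measure.dirac k
  measurable' := by
    refine Measure.measurable_of_measurable_coe _ fun S hS => ?_
    simp only [Measure.sum_apply _ hS, Measure.smul_apply, smul_eq_mul]
    exact Measurable.tsum fun k => (measurable_indexProb α Q P k).mul_const _

instance (α : ℝ) (Q P : Measure 𝒵) : IsMarkovKernel (indexKernel α Q P) := by
  refine ⟨fun ω => ⟨?_⟩⟩
  change (Measure.sum fun k => indexProb α Q P ω.1 ω.2 k • Measure.dirac k) Set.univ = 1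
  simp [tsum_indexProb]

/-- The law of `((Zᵢ)ᵢ, K)` in the Poisson private representation with parameter `α` and proposal
distribution `Q` applied to the distribution `P`: the `Zᵢ` are i.i.d. with law `Q`, independent of
the Poisson process `(Tᵢ)ᵢ`, the index `K` is drawn from its conditional law given
`((Zᵢ)ᵢ, (Tᵢ)ᵢ)`, and `(Tᵢ)ᵢ` is forgotten. -/
def law (α : ℝ) (Q : Measure 𝒵) [IsProbabilityMeasure Q] (P : Measure 𝒵) :
    Measure ((ℕ → 𝒵) × ℕ) :=
  (((Measure.infinitePi fun _ : ℕ => Q).prod poissonProcess) ⊗ₘ indexKernel α Q P).map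
    fun p => (p.1.1, p.2)

instance (α : ℝ) (Q : Measure 𝒵) [IsProbabilityMeasure Q] (P : Measure 𝒵) :
    IsProbabilityMeasure (law α Q P) :=
  Measure.isProbabilityMeasure_map (by fun_prop)

end PPR

end

noncomputable section

namespace PPR

/-! Fix neighbors `x`, `x'`, let `f`, `g` be the densities of `P x`, `P x'` with respect to `Q`, and
put `b = e^ε`, `m = min f (b g)`, `M = max f (g / b)`. Give the `k`-th point the share it would get
if it competed with density `m` while all other points had density `M`. A point's selection
probability increases with its own weight and decreases with the others', so the share is at most
the selection probability under `f`, and at most `b^(2α)` times the one under `g`. Bounding the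
shares in the first way outside the event `S` and in the second way inside it gives `law_P S + q ≤ 1
+ b^(2α) law_P' S`, where `q` is the expected total share.

It remains to show `q ≥ 1 - 2δ`. By the Mecke formula (`mecke`) and the scaling of the rate-one
process, `q` is `∫ m` times a constant that depends only on `M`. For `m = M` the shares sum to one,
so the constant is `1 / ∫ M` and `q = ∫ m / ∫ M`. Privacy in one direction gives `∫ m ≥ 1 - δ`, and
in the other `∫ M ≤ 1 + δ`. -/

/-! ### Inserting and removing one entry of a sequence -/

/-- The increasing enumeration of `ℕ \ {k}`. -/
def skip (k j : ℕ) : ℕ := if j < k then j else j + 1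

/-- Insert `x` at position `k` of the sequence `u`. -/
def insertAt {X : Type*} (k : ℕ) (x : X) (u : ℕ → X) (i : ℕ) : X :=
  if i = k then x else u (if i < k then i else i - 1)

lemma skip_injective (k : ℕ) : Function.Injective (skip k) := by
  intro a b h
  simp only [skip] at h
  grind

lemma skip_ne (k j : ℕ) : skip k j ≠ k := by
  simp only [skip]
  grind

lemma exists_skip_eq {k i : ℕ} (h : i ≠ k) : ∃ j, skip k j = i := by
  refine ⟨if i < k then i else i - 1, ?_⟩
  simp only [skip]
  grind

@[simp] lemma insertAt_self {X : Type*} (k : ℕ) (x : X) (u : ℕ → X) : insertAt k x u k = x := by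
  simp [insertAt]

@[simp] lemma insertAt_skip {X : Type*} (k : ℕ) (x : X) (u : ℕ → X) (j : ℕ) :
    insertAt k x u (skip k j) = u j := by
  simp only [insertAt, skip]
  grind

lemma measurable_insertAt {X : Type*} [MeasurableSpace X] (k : ℕ) :
    Measurable fun p : X × (ℕ → X) => insertAt k p.1 p.2 := by
  refine measurable_pi_lambda _ fun i => ?_
  unfold insertAt
  split_ifs <;> fun_prop

lemma tsum_eq_add_tsum_skip (a : ℕ → ℝ≥0∞) (k : ℕ) :
    ∑' i, a i = a k + ∑' j, a (skip k j) := by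
  have h : Function.support (Function.update a k 0) ⊆ Set.range (skip k) := by
    intro i hi
    have : i ≠ k := by
      rintro rfl
      simp at hi
    exact exists_skip_eq this
  have h1 : ∑' i, a i = a k + ∑' i, Function.update a k 0 i := by
    rw [ENNReal.tsum_eq_add_tsum_ite k]
    congr 1
    refine tsum_congr fun i => ?_
    by_cases hi : i = k
    · rw [if_pos hi, hi, Function.update_self]
    · rw [if_neg hi, Function.update_of_ne hi]
  rw [h1, ← (skip_injective k).tsum_eq h]
  congr 1
  exact tsum_congr fun j => Function.update_of_ne (skip_ne k j) _ _

/-- Inserting an independent sample into an i.i.d. sequence yields an i.i.d. sequence. -/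
lemma map_insertAt_infinitePi {X : Type*} [MeasurableSpace X] (μ : Measure X)
    [IsProbabilityMeasure μ] (k : ℕ) :
    (μ.prod (Measure.infinitePi fun _ : ℕ => μ)).map (fun p => insertAt k p.1 p.2)
      = Measure.infinitePi fun _ : ℕ => μ := by
  classical
  refine Measure.eq_infinitePi _ fun s t ht => ?_
  rw [Measure.map_apply (measurable_insertAt k) (.pi s.countable_toSet fun i _ => ht i)]
  have hpre : (fun p : X × (ℕ → X) => insertAt k p.1 p.2) ⁻¹' Set.pi s t
      = (if k ∈ s then t k else Set.univ) ×ˢ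
        Set.pi (s.preimage (skip k) (skip_injective k).injOn : Finset ℕ) fun j => t (skip k j) := by
    ext ⟨x, u⟩
    simp only [Set.mem_preimage, Set.mem_pi, Set.mem_prod, Finset.mem_coe, Finset.mem_preimage]
    constructor
    · intro h
      refine ⟨?_, fun j hj => by simpa using h _ hj⟩
      split_ifs with hk
      · simpa using h k hk
      · trivial
    · rintro ⟨h1, h2⟩ i hi
      rcases eq_or_ne i k with rfl | hik
      · simpa [hi] using h1
      · obtain ⟨j, rfl⟩ := exists_skip_eq hik
        simpa using h2 j hi
  rw [hpre, Measure.prod_prod, Measure.infinitePi_pi _ fun i _ => ht _]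
  rw [Finset.prod_preimage' (skip k) s (skip_injective k).injOn fun i => μ (t i)]
  have hfil : s.filter (fun i => i ∈ Set.range (skip k)) = s.erase k := by
    ext i
    simp only [Finset.mem_filter, Finset.mem_erase, Set.mem_range]
    constructor
    · rintro ⟨h, j, rfl⟩
      exact ⟨skip_ne k j, h⟩
    · rintro ⟨h, h'⟩
      exact ⟨h', exists_skip_eq h⟩
  rw [hfil]
  split_ifs with hk
  · exact Finset.mul_prod_erase s (fun i => μ (t i)) hk
  · rw [measure_univ, one_mul, Finset.erase_eq_of_notMem hk]

lemma lintegral_infinitePi_eq_insertAt {X : Type*} [MeasurableSpace X] (μ : Measure X)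
    [IsProbabilityMeasure μ] (k : ℕ) {F : (ℕ → X) → ℝ≥0∞} (hF : Measurable F) :
    ∫⁻ u, F u ∂(Measure.infinitePi fun _ : ℕ => μ)
      = ∫⁻ x, ∫⁻ u, F (insertAt k x u) ∂(Measure.infinitePi fun _ : ℕ => μ) ∂μ := by
  conv_lhs => rw [← map_insertAt_infinitePi μ k]
  rw [lintegral_map hF (measurable_insertAt k),
    lintegral_prod _ (by exact (hF.comp (measurable_insertAt k)).aemeasurable)]

/-! ### Exponential increments and memorylessness -/

lemma lintegral_expMeasure_one (f : ℝ → ℝ≥0∞) (hf : Measurable f) :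
    ∫⁻ s, f s ∂(expMeasure 1) = ∫⁻ s in Set.Ioi 0, ENNReal.ofReal (Real.exp (-s)) * f s := by
  change ∫⁻ s, f s ∂(volume.withDensity (exponentialPDF 1)) = _
  have hm : Measurable (exponentialPDF 1) := (measurable_exponentialPDFReal 1).ennreal_ofReal
  rw [lintegral_withDensity_eq_lintegral_mul _ hm hf,
    setLIntegral_congr (Ioi_ae_eq_Ici (μ := volume) (a := (0 : ℝ))),
    ← lintegral_indicator measurableSet_Ici]
  refine lintegral_congr fun s => ?_
  by_cases hs : 0 ≤ s
  · simp [Set.indicator, hs, exponentialPDF_of_nonneg hs]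
  · simp [Set.indicator, hs, exponentialPDF_of_neg (not_le.1 hs)]

/-- The exponential distribution is memoryless. -/
lemma exp_mul_lintegral_add_expMeasure_one {f : ℝ → ℝ≥0∞} (hf : Measurable f) {s : ℝ}
    (hs : 0 < s) :
    ENNReal.ofReal (Real.exp (-s)) * ∫⁻ v, f (v + s) ∂(expMeasure 1)
      = ∫⁻ v, (Set.Ioi s).indicator f v ∂(expMeasure 1) := by
  rw [lintegral_expMeasure_one _ (by fun_prop),
    lintegral_expMeasure_one _ (hf.indicator measurableSet_Ioi),
    ← lintegral_const_mul _ (by fun_prop), ← lintegral_indicator measurableSet_Ioi,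
    ← lintegral_indicator measurableSet_Ioi, ← lintegral_add_right_eq_self _ (-s)]
  refine lintegral_congr fun v => ?_
  by_cases h : s < v
  · have h1 : 0 < v - s := sub_pos.2 h
    have h2 : 0 < v := hs.trans h
    simp only [Set.indicator, Set.mem_Ioi, ← sub_eq_add_neg, h, h1, h2, if_true,
      sub_add_cancel]
    rw [← mul_assoc, ← ENNReal.ofReal_mul (Real.exp_pos _).le, ← Real.exp_add]
    congr 3
    ring
  · have h1 : ¬ 0 < v + -s := by linarith
    simp [Set.indicator, h, h1]

/-- The law of the inter-arrival times of a Poisson process of rate `1`. -/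
abbrev incrementLaw : Measure (ℕ → ℝ) := Measure.infinitePi fun _ : ℕ => expMeasure 1

/-- Memorylessness of one of the increments of a Poisson process. -/
lemma exp_mul_lintegral_update_incrementLaw {J : (ℕ → ℝ) → ℝ≥0∞} (hJ : Measurable J) (k : ℕ)
    {s : ℝ} (hs : 0 < s) :
    ENNReal.ofReal (Real.exp (-s)) * ∫⁻ e, J (Function.update e k (e k + s)) ∂incrementLaw
      = ∫⁻ e, {e : ℕ → ℝ | s < e k}.indicator J e ∂incrementLaw := by
  have hset : MeasurableSet {e : ℕ → ℝ | s < e k} :=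
    measurableSet_lt measurable_const (measurable_pi_apply k)
  have hupd : Measurable fun e : ℕ → ℝ => Function.update e k (e k + s) := by
    refine measurable_pi_lambda _ fun i => ?_
    by_cases h : i = k
    · subst h
      simp only [Function.update_self]
      fun_prop
    · simp only [Function.update_of_ne h]
      fun_prop
  have hupd' (x : ℝ) (u : ℕ → ℝ) :
      Function.update (insertAt k x u) k (insertAt k x u k + s) = insertAt k (x + s) u := by
    funext i
    by_cases h : i = k
    · subst h; simp
    · simp [insertAt, h]
  have hJi : Measurable fun x : ℝ => ∫⁻ u, J (insertAt k x u) ∂incrementLaw :=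
    (hJ.comp (measurable_insertAt k)).lintegral_prod_right'
  rw [lintegral_infinitePi_eq_insertAt _ k (by exact hJ.comp hupd :
      Measurable fun e => J (Function.update e k (e k + s))),
    lintegral_infinitePi_eq_insertAt _ k (hJ.indicator hset)]
  simp only [hupd']
  rw [exp_mul_lintegral_add_expMeasure_one hJi hs]
  refine lintegral_congr fun v => ?_
  by_cases h : s < v <;> simp [Set.indicator, h]


/-! ### The Mecke formula -/

lemma arrivalTimes_insertAt_self (k : ℕ) (s : ℝ) (e : ℕ → ℝ) :
    arrivalTimes (insertAt k s e) k = ∑ j ∈ Finset.range k, e j + s := by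
  rw [arrivalTimes, Finset.sum_range_succ, insertAt_self]
  congr 1
  refine Finset.sum_congr rfl fun j hj => ?_
  have := Finset.mem_range.1 hj
  simp [insertAt, this, this.ne]

/-- Deleting an arrival merges the two increments on either side of it, here `s` and `e k`. -/
lemma arrivalTimes_insertAt_skip (k : ℕ) (s : ℝ) (e : ℕ → ℝ) (j : ℕ) :
    arrivalTimes (insertAt k s e) (skip k j)
      = arrivalTimes (Function.update e k (e k + s)) j := by
  -- The two partial sums differ only at `n = k`: there `skip` has already passed the inserted `s`,
  -- while the updated entry that absorbs `s` is not yet summed.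
  have hsum (n : ℕ) : ∑ i ∈ Finset.range (skip k n), insertAt k s e i
      = ∑ i ∈ Finset.range n, Function.update e k (e k + s) i + if n = k then s else 0 := by
    induction n with
    | zero =>
      rcases Nat.eq_zero_or_pos k with rfl | hk
      · simp [skip]
      · simp [skip, hk, hk.ne]
    | succ n ih =>
      rw [Finset.sum_range_succ _ n]
      rcases lt_trichotomy n k with h | rfl | h
      · have hn : skip k n = n := by simp [skip, h]
        rw [hn, if_neg h.ne, add_zero] at ih
        rw [← ih, Function.update_of_ne h.ne]
        rcases (Nat.succ_le_of_lt h).eq_or_lt with rfl | h'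
        · simp [skip, Finset.sum_range_succ, insertAt]
        · simp [skip, h', h'.ne, Finset.sum_range_succ, insertAt, h, h.ne]
      · have hn : skip n n = n + 1 := by simp [skip]
        have hn' : skip n (n + 1) = n + 1 + 1 := by simp [skip]
        rw [hn, if_pos rfl] at ih
        rw [hn', Finset.sum_range_succ, ih]
        simp [insertAt]
        ring
      · have hn : skip k n = n + 1 := by simp [skip, h.le.not_gt]
        have hn' : skip k (n + 1) = n + 1 + 1 := by simp [skip, (h.trans n.lt_succ_self).le.not_gt]
        rw [hn, if_neg h.ne'] at ih
        rw [hn', Finset.sum_range_succ, ih, Function.update_of_ne h.ne']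
        have h1 : n + 1 ≠ k := by lia
        have h2 : ¬ n + 1 < k := by lia
        simp [insertAt, h1, h2]
  rw [arrivalTimes, arrivalTimes, Finset.sum_range_succ, Finset.sum_range_succ, hsum,
    insertAt_skip]
  by_cases h : j = k
  · subst h
    simp
    ring
  · simp [h]

/-- The `k`-th increment has density `e^(-s)`, and deleting its arrival lengthens the next increment
by `s`. Memorylessness trades both for the restriction `s < e k`. The deleted arrival is thus spread
with Lebesgue measure over the `k`-th gap of an unchanged Poisson process. -/
lemma lintegral_arrivalTimes_skip {H : ℝ → (ℕ → ℝ) → ℝ≥0∞}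
    (hH : Measurable fun p : ℝ × (ℕ → ℝ) => H p.1 p.2) (k : ℕ) :
    ∫⁻ e, H (arrivalTimes e k) (fun j => arrivalTimes e (skip k j)) ∂incrementLaw
      = ∫⁻ e, (∫⁻ s in Set.Ioi 0, {s : ℝ | s < e k}.indicator
          (fun s => H (∑ j ∈ Finset.range k, e j + s) (arrivalTimes e)) s) ∂incrementLaw := by
  have hT := measurable_arrivalTimes
  have hTi (i : ℕ) : Measurable fun e : ℕ → ℝ => arrivalTimes e i :=
    (measurable_pi_apply i).comp hT
  have hskip : Measurable fun e : ℕ → ℝ => fun j => arrivalTimes e (skip k j) :=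
    measurable_pi_lambda _ fun j => hTi _
  have hF : Measurable fun e : ℕ → ℝ =>
      H (arrivalTimes e k) (fun j => arrivalTimes e (skip k j)) :=
    hH.comp ((hTi k).prodMk hskip)
  have hFi : Measurable fun s : ℝ => ∫⁻ e, H (arrivalTimes (insertAt k s e) k)
      (fun j => arrivalTimes (insertAt k s e) (skip k j)) ∂incrementLaw :=
    (hF.comp (measurable_insertAt k)).lintegral_prod_right'
  rw [lintegral_infinitePi_eq_insertAt _ k hF, lintegral_expMeasure_one _ hFi,
    lintegral_lintegral_swap]
  · refine setLIntegral_congr_fun measurableSet_Ioi fun s hs => ?_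
    have hJ : Measurable fun e : ℕ → ℝ =>
        H (∑ j ∈ Finset.range k, e j + s) (arrivalTimes e) :=
      hH.comp (Measurable.prodMk (by fun_prop) hT)
    have key := exp_mul_lintegral_update_incrementLaw hJ k hs
    refine Eq.trans ?_ (key.trans (lintegral_congr fun e => ?_))
    · congr 1
      refine lintegral_congr fun e => ?_
      rw [arrivalTimes_insertAt_self]
      have h1 : ∑ j ∈ Finset.range k, Function.update e k (e k + s) j
          = ∑ j ∈ Finset.range k, e j :=
        Finset.sum_congr rfl fun j hj =>
          Function.update_of_ne (Finset.mem_range.1 hj).ne _ _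
      rw [h1]
      congr 1
      funext j
      exact arrivalTimes_insertAt_skip k s e j
    · simp [Set.indicator]
  · have hset : MeasurableSet {p : (ℕ → ℝ) × ℝ | p.2 < p.1 k} :=
      measurableSet_lt measurable_snd ((measurable_pi_apply k).comp measurable_fst)
    have hm : Measurable fun p : (ℕ → ℝ) × ℝ =>
        H (∑ j ∈ Finset.range k, p.1 j + p.2) (arrivalTimes p.1) :=
      hH.comp (Measurable.prodMk (by fun_prop) (hT.comp measurable_fst))
    exact (hm.indicator hset).aemeasurable

lemma ae_pos_incrementLaw : ∀ᵐ e ∂incrementLaw, ∀ i, 0 < e i := by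
  refine ae_all_iff.2 fun i => ?_
  have h : ∀ᵐ x ∂(expMeasure 1), 0 < x := by
    have hset : MeasurableSet {x : ℝ | ¬ 0 < x} := by
      simp only [not_lt]
      exact measurableSet_Iic
    rw [ae_iff, ← lintegral_indicator_one hset,
      lintegral_expMeasure_one _ (measurable_one.indicator hset)]
    rw [setLIntegral_congr_fun (g := 0) measurableSet_Ioi]
    · simp
    · intro s hs
      have : 0 < s := hs
      simp [this]
  exact (measurePreserving_eval_infinitePi (fun _ : ℕ => expMeasure 1) i).quasiMeasurePreserving.ae h

lemma lintegral_exp_neg_sum (n : ℕ) :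
    ∫⁻ e, ENNReal.ofReal (Real.exp (-∑ j ∈ Finset.range n, e j)) ∂incrementLaw = (2⁻¹) ^ n := by
  have hexp : ∫⁻ s, ENNReal.ofReal (Real.exp (-s)) ∂(expMeasure 1) = 2⁻¹ := by
    have h (s : ℝ) : ENNReal.ofReal (Real.exp (-s)) * ENNReal.ofReal (Real.exp (-s))
        = ENNReal.ofReal (Real.exp (-2 * s)) := by
      rw [← ENNReal.ofReal_mul (Real.exp_pos _).le, ← Real.exp_add]
      congr 2
      ring
    have hint := integrableOn_exp_mul_Ioi (a := -2) (by norm_num) 0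
    rw [lintegral_expMeasure_one _ (by fun_prop)]
    simp_rw [h]
    rw [← ofReal_integral_eq_lintegral_ofReal hint (ae_of_all _ fun s => (Real.exp_pos _).le),
      integral_exp_mul_Ioi (by norm_num)]
    simp
  induction n with
  | zero => simp
  | succ n ih =>
    rw [lintegral_infinitePi_eq_insertAt _ n (by fun_prop)]
    have (x : ℝ) (u : ℕ → ℝ) : ENNReal.ofReal
        (Real.exp (-∑ j ∈ Finset.range (n + 1), insertAt n x u j))
        = ENNReal.ofReal (Real.exp (-x)) *
          ENNReal.ofReal (Real.exp (-∑ j ∈ Finset.range n, u j)) := by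
      have h := arrivalTimes_insertAt_self n x u
      rw [arrivalTimes] at h
      rw [h, ← ENNReal.ofReal_mul (Real.exp_pos _).le, ← Real.exp_add]
      congr 2
      ring
    simp only [this]
    simp_rw [lintegral_const_mul' _ _ ENNReal.ofReal_ne_top, ih]
    rw [lintegral_mul_const _ (by fun_prop), hexp, pow_succ, mul_comm]

/-- The series of `exp (-Tₙ)` has a finite expectation, a geometric series of ratio `1/2`; so it
converges almost surely, which a bound on the arrival times would prevent. -/
lemma ae_unbounded_incrementLaw :
    ∀ᵐ e ∂incrementLaw, ¬ BddAbove (Set.range fun n => ∑ j ∈ Finset.range n, e j) := by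
  have h : ∫⁻ e, ∑' n, ENNReal.ofReal (Real.exp (-∑ j ∈ Finset.range n, e j)) ∂incrementLaw
      ≠ ∞ := by
    rw [lintegral_tsum fun n => by fun_prop]
    simp_rw [lintegral_exp_neg_sum]
    rw [ENNReal.tsum_geometric]
    simp
  filter_upwards [ae_lt_top (by fun_prop) h] with e he
  rintro ⟨B, hB⟩
  have h0 := ENNReal.tendsto_atTop_zero_of_tsum_ne_top he.ne
  have hpos : 0 < ENNReal.ofReal (Real.exp (-B)) := ENNReal.ofReal_pos.2 (Real.exp_pos _)
  obtain ⟨n, hn⟩ := (h0.eventually_lt_const hpos).exists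
  refine hn.not_ge (ENNReal.ofReal_le_ofReal (Real.exp_le_exp.2 (neg_le_neg ?_)))
  exact hB ⟨n, rfl⟩

/-- The gaps between successive arrival times of a Poisson process partition the half-line. -/
lemma tsum_lintegral_gap {e : ℕ → ℝ} (he : ∀ i, 0 < e i)
    (hu : ¬ BddAbove (Set.range fun n => ∑ j ∈ Finset.range n, e j)) (h : ℝ → ℝ≥0∞) :
    ∑' k, ∫⁻ s in Set.Ioi 0, {s : ℝ | s < e k}.indicator
        (fun s => h (∑ j ∈ Finset.range k, e j + s)) s
      = ∫⁻ t in Set.Ioi 0, h t := by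
  set a : ℕ → ℝ := fun n => ∑ j ∈ Finset.range n, e j with ha
  have hmono : Monotone a := monotone_nat_of_le_succ fun n => by
    simp only [ha, Finset.sum_range_succ]
    linarith [he n]
  have hIoi : Set.Ioi (0 : ℝ) = ⋃ n, Set.Ioc (a n) (a (Order.succ n)) := by
    rw [iUnion_Ioc_map_succ_eq_Ioi]
    · simp [ha]
    · exact fun n => hmono bot_le
    · exact hu
  rw [hIoi, lintegral_iUnion (fun n => measurableSet_Ioc) hmono.pairwise_disjoint_on_Ioc_succ,
    ← hIoi]
  refine tsum_congr fun k => ?_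
  rw [← setLIntegral_congr (Ioo_ae_eq_Ioc (μ := volume)),
    ← lintegral_indicator measurableSet_Ioi, ← lintegral_indicator measurableSet_Ioo]
  symm
  rw [← lintegral_add_right_eq_self _ (a k)]
  refine lintegral_congr fun s => ?_
  have h1 : a (Order.succ k) = a k + e k := by
    simp [ha, Finset.sum_range_succ]
  rw [h1]
  by_cases hs : 0 < s <;> by_cases hs' : s < e k <;>
    simp [Set.indicator, hs, hs', ha, add_comm]

/-- The Mecke formula without marks: the `k`-th term integrates over the `k`-th gap, and almost
surely the gaps exhaust the half-line. -/
lemma tsum_lintegral_poissonProcess_skip {H : ℝ → (ℕ → ℝ) → ℝ≥0∞}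
    (hH : Measurable fun p : ℝ × (ℕ → ℝ) => H p.1 p.2) :
    ∑' k, ∫⁻ t, H (t k) (fun j => t (skip k j)) ∂(poissonProcess)
      = ∫⁻ s in Set.Ioi 0, (∫⁻ t, H s t ∂(poissonProcess)) := by
  have hT := measurable_arrivalTimes
  have hskip (k : ℕ) : Measurable fun t : ℕ → ℝ => H (t k) (fun j => t (skip k j)) :=
    hH.comp (by fun_prop : Measurable fun t : ℕ → ℝ => (t k, fun j => t (skip k j)))
  have hHT : Measurable fun p : (ℕ → ℝ) × ℝ => H p.2 (arrivalTimes p.1) :=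
    hH.comp (measurable_snd.prodMk (hT.comp measurable_fst))
  have hgap (k : ℕ) : Measurable fun e : ℕ → ℝ =>
      ∫⁻ s in Set.Ioi 0, {s : ℝ | s < e k}.indicator
          (fun s => H (∑ j ∈ Finset.range k, e j + s) (arrivalTimes e)) s := by
    have hset : MeasurableSet {p : (ℕ → ℝ) × ℝ | p.2 < p.1 k} :=
      measurableSet_lt measurable_snd ((measurable_pi_apply k).comp measurable_fst)
    have hm : Measurable fun p : (ℕ → ℝ) × ℝ =>
        H (∑ j ∈ Finset.range k, p.1 j + p.2) (arrivalTimes p.1) :=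
      hH.comp (Measurable.prodMk (by fun_prop) (hT.comp measurable_fst))
    exact (hm.indicator hset).lintegral_prod_right'
  have h1 (k : ℕ) : ∫⁻ t, H (t k) (fun j => t (skip k j)) ∂(poissonProcess)
      = ∫⁻ e, (∫⁻ s in Set.Ioi 0, {s : ℝ | s < e k}.indicator
          (fun s => H (∑ j ∈ Finset.range k, e j + s) (arrivalTimes e)) s) ∂incrementLaw := by
    rw [poissonProcess, lintegral_map (hskip k) hT, lintegral_arrivalTimes_skip hH]
  simp_rw [h1]
  rw [← lintegral_tsum fun k => (hgap k).aemeasurable]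
  have h2 : ∀ᵐ e ∂incrementLaw, ∑' k, (∫⁻ s in Set.Ioi 0, {s : ℝ | s < e k}.indicator
          (fun s => H (∑ j ∈ Finset.range k, e j + s) (arrivalTimes e)) s)
        = ∫⁻ s in Set.Ioi 0, H s (arrivalTimes e) := by
    filter_upwards [ae_pos_incrementLaw, ae_unbounded_incrementLaw] with e he hu
    exact tsum_lintegral_gap he hu fun s => H s (arrivalTimes e)
  rw [lintegral_congr_ae h2, lintegral_lintegral_swap (by exact hHT.aemeasurable)]
  refine lintegral_congr fun s => ?_
  rw [poissonProcess, lintegral_map (by exact hH.comp measurable_prodMk_left) hT]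

/-- The Mecke formula for an i.i.d. marked Poisson process of rate `1`. -/
lemma mecke {𝒵 : Type*} [MeasurableSpace 𝒵] (Q : Measure 𝒵) [IsProbabilityMeasure Q]
    {F : 𝒵 → ℝ → (ℕ → 𝒵) × (ℕ → ℝ) → ℝ≥0∞}
    (hF : Measurable fun p : 𝒵 × ℝ × (ℕ → 𝒵) × (ℕ → ℝ) => F p.1 p.2.1 p.2.2) :
    ∫⁻ ω, ∑' k, F (ω.1 k) (ω.2 k) (fun j => ω.1 (skip k j), fun j => ω.2 (skip k j))
        ∂((Measure.infinitePi fun _ : ℕ => Q).prod poissonProcess)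
      = ∫⁻ z, (∫⁻ s in Set.Ioi 0, (∫⁻ ω, F z s ω
        ∂((Measure.infinitePi fun _ : ℕ => Q).prod poissonProcess))) ∂Q := by
  have hsk {X : Type _} [MeasurableSpace X] (k : ℕ) :
      Measurable fun (u : ℕ → X) (j : ℕ) => u (skip k j) :=
    measurable_pi_lambda _ fun j => measurable_pi_apply _
  have hsk' (k : ℕ) : Measurable fun (u : ℕ → ℝ) (j : ℕ) => u (skip k j) :=
    measurable_pi_lambda _ fun j => measurable_pi_apply _
  have hk (k : ℕ) : Measurable fun ω : (ℕ → 𝒵) × (ℕ → ℝ) =>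
      F (ω.1 k) (ω.2 k) (fun j => ω.1 (skip k j), fun j => ω.2 (skip k j)) :=
    hF.comp (Measurable.prodMk ((measurable_pi_apply k).comp measurable_fst)
      (Measurable.prodMk ((measurable_pi_apply k).comp measurable_snd)
        (((hsk k).comp measurable_fst).prodMk ((hsk' k).comp measurable_snd))))
  have hk2 (k : ℕ) : Measurable fun p : (𝒵 × (ℕ → 𝒵)) × (ℕ → ℝ) =>
      F p.1.1 (p.2 k) (p.1.2, fun j => p.2 (skip k j)) :=
    hF.comp (Measurable.prodMk (by fun_prop) (Measurable.prodMk (by fun_prop)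
      (Measurable.prodMk (by fun_prop) ((hsk' k).comp measurable_snd))))
  have hk3 (k : ℕ) : Measurable fun p : 𝒵 × (ℕ → 𝒵) => ∫⁻ t,
      F p.1 (t k) (p.2, fun j => t (skip k j)) ∂(poissonProcess) :=
    (hk2 k).lintegral_prod_right'
  have h1 (k : ℕ) : ∫⁻ ω, F (ω.1 k) (ω.2 k) (fun j => ω.1 (skip k j), fun j => ω.2 (skip k j))
        ∂((Measure.infinitePi fun _ : ℕ => Q).prod poissonProcess)
      = ∫⁻ z, ∫⁻ ζ, (∫⁻ t, F z (t k) (ζ, fun j => t (skip k j)) ∂(poissonProcess))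
          ∂(Measure.infinitePi fun _ : ℕ => Q) ∂Q := by
    rw [lintegral_prod _ (hk k).aemeasurable, lintegral_infinitePi_eq_insertAt _ k
      (by exact (hk k).lintegral_prod_right')]
    simp
  rw [lintegral_tsum fun k => (hk k).aemeasurable]
  simp_rw [h1]
  rw [← lintegral_tsum fun k => (by exact (hk3 k).lintegral_prod_right'.aemeasurable)]
  refine lintegral_congr fun z => ?_
  rw [← lintegral_tsum fun k => (by exact ((hk3 k).comp measurable_prodMk_left).aemeasurable)]
  have h2 (ζ : ℕ → 𝒵) := tsum_lintegral_poissonProcess_skip (H := fun s t => F z s (ζ, t))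
    (hF.comp (by fun_prop : Measurable fun p : ℝ × (ℕ → ℝ) => (z, p.1, ζ, p.2)))
  simp_rw [h2]
  have h3 : Measurable fun p : ((ℕ → 𝒵) × ℝ) × (ℕ → ℝ) => F z p.1.2 (p.1.1, p.2) :=
    hF.comp (by fun_prop : Measurable fun p : ((ℕ → 𝒵) × ℝ) × (ℕ → ℝ) => (z, p.1.2, p.1.1, p.2))
  rw [lintegral_lintegral_swap (by exact h3.lintegral_prod_right'.aemeasurable)]
  refine lintegral_congr fun s => ?_
  rw [lintegral_prod _ (by exact (hF.comp (by fun_prop :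
    Measurable fun ω : (ℕ → 𝒵) × (ℕ → ℝ) => (z, s, ω))).aemeasurable)]


/-! ### Weights, their scaling, and shares -/

/-- The quotient is `1 / (1 + R / x)`. Finiteness of `y` excludes `∞ / ∞`, which is `0`. -/
lemma div_add_self_mono {x y R R' : ℝ≥0∞} (hxy : x ≤ y) (hR : R' ≤ R) (hy : y ≠ ∞) :
    x / (x + R) ≤ y / (y + R') := by
  rcases eq_or_ne x 0 with rfl | hx
  · simp
  have hy0 : y ≠ 0 := fun h => hx (by simpa [h] using hxy)
  have hx' : x ≠ ∞ := ne_top_of_le_ne_top hy hxy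
  rw [← ENNReal.inv_div (a := x + R) (b := x) (.inl hx') (.inl hx),
    ← ENNReal.inv_div (a := y + R') (b := y) (.inl hy) (.inl hy0),
    ENNReal.add_div, ENNReal.add_div, ENNReal.div_self hx hx', ENNReal.div_self hy0 hy]
  exact ENNReal.inv_le_inv.2 (add_le_add_right (ENNReal.div_le_div hR hxy) _)

lemma mul_div_add_self_le {c x R : ℝ≥0∞} (hc : 1 ≤ c) (hc' : c ≠ ∞) :
    c * x / (c * x + c⁻¹ * R) ≤ c ^ 2 * (x / (x + R)) := by
  have hc0 : c ≠ 0 := (one_pos.trans_le hc).ne'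
  have h : c⁻¹ * (x + R) ≤ c * x + c⁻¹ * R := by
    rw [mul_add]
    gcongr
    exact (ENNReal.inv_le_one.2 hc).trans hc
  calc c * x / (c * x + c⁻¹ * R) ≤ c * x / (c⁻¹ * (x + R)) := ENNReal.div_le_div_left h _
    _ = c ^ 2 * (x / (x + R)) := by
      rw [div_eq_mul_inv, ENNReal.mul_inv (.inl (by simpa using hc')) (.inl (by simpa using hc0)),
        inv_inv, div_eq_mul_inv]
      ring

variable {𝒵 : Type*}

/-- The weight of a point with arrival time `t` at which the density takes the value `a`. -/
def pointWeight (α : ℝ) (a : ℝ≥0∞) (t : ℝ) : ℝ≥0∞ := (ENNReal.ofReal t / a) ^ (-α)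

/-- The sum of the weights of all points with respect to the density `f`. -/
def totalWeight (α : ℝ) (f : 𝒵 → ℝ≥0∞) (ω : (ℕ → 𝒵) × (ℕ → ℝ)) : ℝ≥0∞ :=
  ∑' i, pointWeight α (f (ω.1 i)) (ω.2 i)

/-- The sequence of marked points with the `k`-th one removed. -/
def removeAt (k : ℕ) (ω : (ℕ → 𝒵) × (ℕ → ℝ)) : (ℕ → 𝒵) × (ℕ → ℝ) :=
  (fun j => ω.1 (skip k j), fun j => ω.2 (skip k j))

@[fun_prop]
lemma measurable_pointWeight (α : ℝ) : Measurable fun p : ℝ≥0∞ × ℝ => pointWeight α p.1 p.2 := by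
  unfold pointWeight
  fun_prop

lemma totalWeight_eq_add (α : ℝ) (f : 𝒵 → ℝ≥0∞) (ω : (ℕ → 𝒵) × (ℕ → ℝ)) (k : ℕ) :
    totalWeight α f ω = pointWeight α (f (ω.1 k)) (ω.2 k) + totalWeight α f (removeAt k ω) :=
  tsum_eq_add_tsum_skip _ k

lemma pointWeight_eq (α : ℝ) (a : ℝ≥0∞) {t : ℝ} (ht : 0 < t) :
    pointWeight α a t = (a / ENNReal.ofReal t) ^ α := by
  rw [pointWeight, ENNReal.rpow_neg, ← ENNReal.inv_rpow,
    ENNReal.inv_div (.inr ENNReal.ofReal_ne_top) (.inr (ENNReal.ofReal_pos.2 ht).ne')]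

lemma pointWeight_mono {α : ℝ} (hα : 0 < α) {a b : ℝ≥0∞} (hab : a ≤ b) {t : ℝ} (ht : 0 < t) :
    pointWeight α a t ≤ pointWeight α b t := by
  rw [pointWeight_eq _ _ ht, pointWeight_eq _ _ ht]
  exact ENNReal.rpow_le_rpow (ENNReal.div_le_div_right hab _) hα.le

lemma pointWeight_mul {α : ℝ} (hα : 0 < α) (c a : ℝ≥0∞) {t : ℝ} (ht : 0 < t) :
    pointWeight α (c * a) t = c ^ α * pointWeight α a t := by
  rw [pointWeight_eq _ _ ht, pointWeight_eq _ _ ht, mul_div_assoc,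
    ENNReal.mul_rpow_of_nonneg _ _ hα.le]

lemma pointWeight_ne_top {α : ℝ} (hα : 0 < α) {a : ℝ≥0∞} (ha : a ≠ ∞) {t : ℝ} (ht : 0 < t) :
    pointWeight α a t ≠ ∞ := by
  rw [pointWeight_eq _ _ ht]
  exact ENNReal.rpow_ne_top_of_nonneg hα.le
    (ENNReal.div_ne_top ha (ENNReal.ofReal_pos.2 ht).ne')

lemma pointWeight_ne_zero {α : ℝ} (hα : 0 < α) {a : ℝ≥0∞} (ha : a ≠ 0) {t : ℝ} (ht : 0 < t) :
    pointWeight α a t ≠ 0 := by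
  rw [pointWeight_eq _ _ ht]
  simp [ENNReal.rpow_eq_zero_iff, hα, ha, hα.not_gt]

lemma lintegral_Ioi_mul_left {h : ℝ → ℝ≥0∞} (hh : Measurable h) {c : ℝ} (hc : 0 < c) :
    ∫⁻ t in Set.Ioi 0, h t = ENNReal.ofReal c * ∫⁻ s in Set.Ioi 0, h (c * s) := by
  rw [← lintegral_indicator measurableSet_Ioi, ← lintegral_indicator measurableSet_Ioi]
  conv_lhs => rw [← Real.smul_map_volume_mul_left hc.ne']
  rw [lintegral_smul_measure, abs_of_pos hc,
    lintegral_map (hh.indicator measurableSet_Ioi) (measurable_const_mul c), smul_eq_mul]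
  congr 1
  refine lintegral_congr fun s => ?_
  by_cases hs : 0 < s <;> simp [Set.indicator, hs, hc]

/-- The substitution `t = a s` works because the weight depends only on `t / a`. The case `a = 0` is
where `G 0 = 0` enters. -/
lemma lintegral_comp_pointWeight {α : ℝ} (hα : 0 < α) {G : ℝ≥0∞ → ℝ≥0∞} (hG : Measurable G)
    (hG0 : G 0 = 0) {a : ℝ≥0∞} (ha : a ≠ ∞) :
    ∫⁻ t in Set.Ioi 0, G (pointWeight α a t)
      = a * ∫⁻ s in Set.Ioi 0, G (pointWeight α 1 s) := by
  rcases eq_or_ne a 0 with rfl | ha0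
  · rw [zero_mul, setLIntegral_congr_fun (g := 0) measurableSet_Ioi]
    · simp
    · intro t ht
      simp [pointWeight_eq α 0 (t := t) ht, hα, hG0]
  have hc : 0 < a.toReal := ENNReal.toReal_pos ha0 ha
  have hm : Measurable fun t : ℝ => G (pointWeight α a t) :=
    hG.comp ((measurable_pointWeight α).comp (f := fun t : ℝ => (a, t)) (by fun_prop))
  rw [lintegral_Ioi_mul_left hm hc, ENNReal.ofReal_toReal ha]
  congr 1
  refine setLIntegral_congr_fun measurableSet_Ioi fun s hs => ?_
  rw [pointWeight, pointWeight, ENNReal.ofReal_mul hc.le, ENNReal.ofReal_toReal ha, div_one,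
    mul_comm, ENNReal.mul_div_cancel_right ha0 ha]

/-- The cap at `1` controls small times; at large times `s^(-α)` is integrable since `α > 1`. -/
lemma lintegral_min_pointWeight_ne_top {α : ℝ} (hα : 1 < α) :
    ∫⁻ s in Set.Ioi 0, min 1 (pointWeight α 1 s) ≠ ∞ := by
  have h0 : (0 : ℝ) ≤ 1 := zero_le_one
  rw [← Set.Ioc_union_Ioi_eq_Ioi h0,
    lintegral_union measurableSet_Ioi (Set.disjoint_left.2 fun x hx hx' => hx.2.not_gt hx')]
  refine ENNReal.add_ne_top.2 ⟨ne_top_of_le_ne_top ?_ (lintegral_mono fun s => min_le_left _ _), ?_⟩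
  · simp
  · have hint := integrableOn_Ioi_rpow_of_lt (a := -α) (by linarith) one_pos
    have h1 : ∫⁻ s in Set.Ioi (1 : ℝ), ENNReal.ofReal (s ^ (-α)) ≠ ∞ := hint.lintegral_lt_top.ne
    refine ne_top_of_le_ne_top h1 (setLIntegral_mono' measurableSet_Ioi fun s hs => ?_)
    refine (min_le_right _ _).trans_eq ?_
    have hs0 : 0 < s := one_pos.trans hs
    rw [pointWeight, div_one, ENNReal.ofReal_rpow_of_pos hs0]

/-- The truncated terms tend to zero, so only finitely many terms are truncated, and those are
finite. -/
lemma tsum_ne_top_of_tsum_min_ne_top {a : ℕ → ℝ≥0∞} (ha : ∀ i, a i ≠ ∞)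
    (h : ∑' i, min 1 (a i) ≠ ∞) : ∑' i, a i ≠ ∞ := by
  have h0 := ENNReal.tendsto_atTop_zero_of_tsum_ne_top h
  obtain ⟨n, hn⟩ := Filter.eventually_atTop.1 (h0.eventually_lt_const one_pos)
  have hle (i : ℕ) : a i ≤ min 1 (a i) + if i ∈ Finset.range n then a i else 0 := by
    by_cases hi : i < n
    · simp [hi]
    · have h1 := hn i (not_lt.1 hi)
      rw [min_lt_iff] at h1
      have h2 : a i < 1 := h1.resolve_left (lt_irrefl _)
      simp [h2.le]
  refine ne_top_of_le_ne_top ?_ (ENNReal.tsum_le_tsum hle)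
  rw [ENNReal.tsum_add, tsum_eq_sum (s := Finset.range n) fun i hi => if_neg hi]
  refine ENNReal.add_ne_top.2 ⟨h, ENNReal.sum_ne_top.2 fun i hi => ?_⟩
  rw [if_pos hi]
  exact ha i

/-- The share of the `k`-th point when it competes with density `m` against the other points, which
compete with density `M`. -/
def share (α : ℝ) (m M : 𝒵 → ℝ≥0∞) (ω : (ℕ → 𝒵) × (ℕ → ℝ)) (k : ℕ) : ℝ≥0∞ :=
  pointWeight α (m (ω.1 k)) (ω.2 k)
    / (pointWeight α (m (ω.1 k)) (ω.2 k) + totalWeight α M (removeAt k ω))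

lemma share_le {α : ℝ} (hα : 0 < α) {m M f : 𝒵 → ℝ≥0∞} (hmf : ∀ z, m z ≤ f z)
    (hfM : ∀ z, f z ≤ M z) {ω : (ℕ → 𝒵) × (ℕ → ℝ)} (hω : ∀ i, 0 < ω.2 i) {k : ℕ}
    (hfk : f (ω.1 k) ≠ ∞) :
    share α m M ω k ≤ pointWeight α (f (ω.1 k)) (ω.2 k) / totalWeight α f ω := by
  rw [totalWeight_eq_add α f ω k]
  exact div_add_self_mono (pointWeight_mono hα (hmf _) (hω k))
    (ENNReal.tsum_le_tsum fun i => pointWeight_mono hα (hfM _) (hω _))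
    (pointWeight_ne_top hα hfk (hω k))

/-- The factor `b^α` occurs twice: once because the point's own weight may grow by it, once because
the competitors' weights may shrink by it. -/
lemma share_le_mul {α : ℝ} (hα : 0 < α) {m M g : 𝒵 → ℝ≥0∞} {b : ℝ≥0∞} (hb : 1 ≤ b)
    (hb' : b ≠ ∞) (hmg : ∀ z, m z ≤ b * g z) (hgM : ∀ z, b⁻¹ * g z ≤ M z)
    {ω : (ℕ → 𝒵) × (ℕ → ℝ)} (hω : ∀ i, 0 < ω.2 i) {k : ℕ} (hgk : g (ω.1 k) ≠ ∞) :
    share α m M ω k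
      ≤ (b ^ α) ^ 2 * (pointWeight α (g (ω.1 k)) (ω.2 k) / totalWeight α g ω) := by
  have hc : 1 ≤ b ^ α := ENNReal.one_le_rpow hb hα
  have hc' : b ^ α ≠ ∞ := ENNReal.rpow_ne_top_of_nonneg hα.le hb'
  have hR : (b ^ α)⁻¹ * totalWeight α g (removeAt k ω) ≤ totalWeight α M (removeAt k ω) := by
    rw [totalWeight, totalWeight, ← ENNReal.tsum_mul_left]
    refine ENNReal.tsum_le_tsum fun i => ?_
    rw [← ENNReal.inv_rpow, ← pointWeight_mul hα b⁻¹ _ (t := (removeAt k ω).2 i) (hω _)]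
    exact pointWeight_mono hα (hgM _) (hω _)
  have hx : pointWeight α (m (ω.1 k)) (ω.2 k) ≤ b ^ α * pointWeight α (g (ω.1 k)) (ω.2 k) := by
    rw [← pointWeight_mul hα _ _ (hω _)]
    exact pointWeight_mono hα (hmg _) (hω _)
  rw [totalWeight_eq_add α g ω k]
  exact (div_add_self_mono hx hR
    (ENNReal.mul_ne_top hc' (pointWeight_ne_top hα hgk (hω k)))).trans
    (mul_div_add_self_le hc hc')

/-! ### The expected total share -/

variable [MeasurableSpace 𝒵]

/-- The law of the samples and the arrival times. -/
abbrev sourceLaw (Q : Measure 𝒵) [IsProbabilityMeasure Q] : Measure ((ℕ → 𝒵) × (ℕ → ℝ)) :=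
  (Measure.infinitePi fun _ : ℕ => Q).prod poissonProcess

@[fun_prop]
lemma measurable_totalWeight (α : ℝ) {f : 𝒵 → ℝ≥0∞} (hf : Measurable f) :
    Measurable (totalWeight α f) := by
  unfold totalWeight
  refine Measurable.tsum fun i => ?_
  exact (measurable_pointWeight α).comp (f := fun ω : (ℕ → 𝒵) × (ℕ → ℝ) => (f (ω.1 i), ω.2 i))
    (by fun_prop)

lemma ae_pos_time (Q : Measure 𝒵) [IsProbabilityMeasure Q] :
    ∀ᵐ ω ∂(sourceLaw Q), ∀ i, 0 < ω.2 i := by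
  have h : ∀ᵐ t ∂(poissonProcess), ∀ i, 0 < t i := by
    rw [poissonProcess, ae_map_iff measurable_arrivalTimes.aemeasurable]
    · filter_upwards [ae_pos_incrementLaw] with e he i
      exact Finset.sum_pos (fun j _ => he j) ⟨0, by simp⟩
    · simp only [Set.ofPred_forall]
      exact MeasurableSet.iInter fun i => measurableSet_lt measurable_const (measurable_pi_apply i)
  exact Measure.quasiMeasurePreserving_snd.ae h

lemma ae_forall_sample {Q : Measure 𝒵} [IsProbabilityMeasure Q] {p : 𝒵 → Prop}
    (hp : ∀ᵐ z ∂Q, p z) : ∀ᵐ ω ∂(sourceLaw Q), ∀ i, p (ω.1 i) := by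
  refine Measure.quasiMeasurePreserving_fst.ae (p := fun ζ : ℕ → 𝒵 => ∀ i, p (ζ i)) ?_
  exact ae_all_iff.2 fun i =>
    (measurePreserving_eval_infinitePi (fun _ : ℕ => Q) i).quasiMeasurePreserving.ae hp

lemma ae_exists_sample {Q : Measure 𝒵} [IsProbabilityMeasure Q] {B : Set 𝒵}
    (hB : MeasurableSet B) (hQB : Q B ≠ 1) : ∀ᵐ ω ∂(sourceLaw Q), ∃ i, ω.1 i ∉ B := by
  refine Measure.quasiMeasurePreserving_fst.ae (p := fun ζ : ℕ → 𝒵 => ∃ i, ζ i ∉ B) ?_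
  rw [ae_iff]
  have hlt : Q B < 1 := lt_of_le_of_ne prob_le_one hQB
  -- The first `n` samples all lie in `B` with probability `Q B ^ n`, which tends to zero.
  refine le_antisymm (ge_of_tendsto' (ENNReal.tendsto_pow_atTop_nhds_zero_of_lt_one hlt)
    fun n => ?_) bot_le
  calc _ ≤ (Measure.infinitePi fun _ : ℕ => Q) (Set.pi (Finset.range n : Finset ℕ) fun _ => B) :=
        measure_mono fun ζ hζ i _ => by simpa using not_exists.1 hζ i
    _ = Q B ^ n := by
      rw [Measure.infinitePi_pi _ fun _ _ => hB]
      simp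

/-- Some sample has positive density almost surely, so the sum is not zero. For finiteness, the
Mecke formula bounds the expected sum of the weights capped at `1`; uncapped, the expectation could
be infinite because of small times. -/
lemma ae_totalWeight_ne {α : ℝ} (hα : 1 < α) {Q : Measure 𝒵} [IsProbabilityMeasure Q]
    {f : 𝒵 → ℝ≥0∞} (hf : Measurable f) (h0 : ∫⁻ z, f z ∂Q ≠ 0) (htop : ∫⁻ z, f z ∂Q ≠ ∞) :
    ∀ᵐ ω ∂(sourceLaw Q), totalWeight α f ω ≠ 0 ∧ totalWeight α f ω ≠ ∞ := by
  have hα0 : 0 < α := one_pos.trans hα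
  have hffin : ∀ᵐ z ∂Q, f z < ∞ := ae_lt_top hf htop
  have hB : MeasurableSet {z | f z = 0} := hf (measurableSet_singleton 0)
  have hQB : Q {z | f z = 0} ≠ 1 := by
    intro h
    refine h0 ((lintegral_eq_zero_iff hf).2 ?_)
    exact (prob_compl_eq_zero_iff hB).2 h
  have hw (i : ℕ) : Measurable fun ω : (ℕ → 𝒵) × (ℕ → ℝ) => pointWeight α (f (ω.1 i)) (ω.2 i) :=
    (measurable_pointWeight α).comp (f := fun ω : (ℕ → 𝒵) × (ℕ → ℝ) => (f (ω.1 i), ω.2 i))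
      (by fun_prop)
  have hwF : Measurable fun p : 𝒵 × ℝ × (ℕ → 𝒵) × (ℕ → ℝ) =>
      min 1 (pointWeight α (f p.1) p.2.1) :=
    measurable_const.min ((measurable_pointWeight α).comp
      (f := fun p : 𝒵 × ℝ × (ℕ → 𝒵) × (ℕ → ℝ) => (f p.1, p.2.1)) (by fun_prop))
  have hmecke := mecke Q (F := fun z t _ => min 1 (pointWeight α (f z) t)) hwF
  have hfin : ∫⁻ ω, ∑' k, min 1 (pointWeight α (f (ω.1 k)) (ω.2 k)) ∂(sourceLaw Q) ≠ ∞ := by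
    rw [hmecke]
    have h1 : ∀ᵐ z ∂Q, (∫⁻ s in Set.Ioi 0, (∫⁻ _, min 1 (pointWeight α (f z) s)
        ∂(sourceLaw Q))) = f z * ∫⁻ s in Set.Ioi 0, min 1 (pointWeight α 1 s) := by
      filter_upwards [hffin] with z hz
      simp only [lintegral_const, measure_univ, mul_one]
      exact lintegral_comp_pointWeight hα0 (G := fun x => min 1 x) (by fun_prop) (by simp) hz.ne
    rw [lintegral_congr_ae h1, lintegral_mul_const _ hf]
    exact ENNReal.mul_ne_top htop (lintegral_min_pointWeight_ne_top hα)
  filter_upwards [ae_pos_time Q, ae_forall_sample hffin, ae_exists_sample hB hQB,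
    ae_lt_top (Measurable.tsum fun k => measurable_const.min (hw k)) hfin] with ω ht hz hex hsum
  refine ⟨?_, tsum_ne_top_of_tsum_min_ne_top
    (fun i => pointWeight_ne_top hα0 (hz i).ne (ht i)) hsum.ne⟩
  obtain ⟨i, hi⟩ := hex
  intro h
  exact pointWeight_ne_zero hα0 hi (ht i) (ENNReal.tsum_eq_zero.1 h i)

/-- The factor by which `∫⁻ z, m z ∂Q` has to be multiplied to get the expected sum of the shares
of the points when each competes with density `m` against the others with density `M`. -/
def competitionRate (α : ℝ) (Q : Measure 𝒵) [IsProbabilityMeasure Q] (M : 𝒵 → ℝ≥0∞) : ℝ≥0∞ :=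
  ∫⁻ s in Set.Ioi 0, ∫⁻ ω, pointWeight α 1 s / (pointWeight α 1 s + totalWeight α M ω)
    ∂(sourceLaw Q)

/-- In the Mecke formula the tested point is independent of its competitors, so its density `m z`
enters only through the time scale and comes out as a linear factor. -/
lemma lintegral_tsum_share {α : ℝ} (hα : 1 < α) {Q : Measure 𝒵} [IsProbabilityMeasure Q]
    {m M : 𝒵 → ℝ≥0∞} (hm : Measurable m) (hM : Measurable M) (hmtop : ∫⁻ z, m z ∂Q ≠ ∞) :
    ∫⁻ ω, ∑' k, share α m M ω k ∂(sourceLaw Q) = (∫⁻ z, m z ∂Q) * competitionRate α Q M := by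
  have hα0 : 0 < α := one_pos.trans hα
  have hwF : Measurable fun p : 𝒵 × ℝ × (ℕ → 𝒵) × (ℕ → ℝ) =>
      pointWeight α (m p.1) p.2.1 / (pointWeight α (m p.1) p.2.1 + totalWeight α M p.2.2) := by
    have h1 : Measurable fun p : 𝒵 × ℝ × (ℕ → 𝒵) × (ℕ → ℝ) => pointWeight α (m p.1) p.2.1 :=
      (measurable_pointWeight α).comp
        (f := fun p : 𝒵 × ℝ × (ℕ → 𝒵) × (ℕ → ℝ) => (m p.1, p.2.1)) (by fun_prop)
    exact h1.div (h1.add ((measurable_totalWeight α hM).comp (by fun_prop)))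
  have hmecke := mecke Q (F := fun z t ω =>
    pointWeight α (m z) t / (pointWeight α (m z) t + totalWeight α M ω)) hwF
  refine hmecke.trans ?_
  rw [← lintegral_mul_const _ hm]
  refine lintegral_congr_ae ?_
  filter_upwards [ae_lt_top hm hmtop] with z hz
  have hG : Measurable fun p : ℝ≥0∞ × ((ℕ → 𝒵) × (ℕ → ℝ)) => p.1 / (p.1 + totalWeight α M p.2) :=
    measurable_fst.div (measurable_fst.add ((measurable_totalWeight α hM).comp measurable_snd))
  exact lintegral_comp_pointWeight hα0
    (G := fun x => ∫⁻ ω, x / (x + totalWeight α M ω) ∂(sourceLaw Q))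
    hG.lintegral_prod_right' (by simp) hz.ne

lemma lintegral_tsum_share_self {α : ℝ} (hα : 1 < α) {Q : Measure 𝒵} [IsProbabilityMeasure Q]
    {M : 𝒵 → ℝ≥0∞} (hM : Measurable M) (h0 : ∫⁻ z, M z ∂Q ≠ 0) (htop : ∫⁻ z, M z ∂Q ≠ ∞) :
    ∫⁻ ω, ∑' k, share α M M ω k ∂(sourceLaw Q) = 1 := by
  have h : ∀ᵐ ω ∂(sourceLaw Q), ∑' k, share α M M ω k = 1 := by
    filter_upwards [ae_totalWeight_ne hα hM h0 htop] with ω hω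
    simp only [share, ← totalWeight_eq_add, div_eq_mul_inv]
    rw [ENNReal.tsum_mul_right]
    exact ENNReal.mul_inv_cancel hω.1 hω.2
  rw [lintegral_congr_ae h]
  simp

/-- The case `m = M`, where the shares sum to one, identifies `competitionRate` as the inverse of `∫
M`, so it need not be computed. -/
lemma mul_lintegral_tsum_share {α : ℝ} (hα : 1 < α) {Q : Measure 𝒵} [IsProbabilityMeasure Q]
    {m M : 𝒵 → ℝ≥0∞} (hm : Measurable m) (hM : Measurable M) (hmtop : ∫⁻ z, m z ∂Q ≠ ∞)
    (h0 : ∫⁻ z, M z ∂Q ≠ 0) (htop : ∫⁻ z, M z ∂Q ≠ ∞) :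
    (∫⁻ z, M z ∂Q) * ∫⁻ ω, ∑' k, share α m M ω k ∂(sourceLaw Q) = ∫⁻ z, m z ∂Q := by
  have h := lintegral_tsum_share_self hα hM h0 htop
  rw [lintegral_tsum_share hα hM hM htop] at h
  rw [lintegral_tsum_share hα hm hM hmtop, mul_left_comm, h, mul_one]


/-! ### Comparison of the two output laws -/

lemma indexProb_eq {α : ℝ} {Q P : Measure 𝒵} {ω : (ℕ → 𝒵) × (ℕ → ℝ)}
    (h : totalWeight α (P.rnDeriv Q) ω ≠ 0 ∧ totalWeight α (P.rnDeriv Q) ω ≠ ∞) (k : ℕ) :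
    indexProb α Q P ω.1 ω.2 k
      = pointWeight α (P.rnDeriv Q (ω.1 k)) (ω.2 k) / totalWeight α (P.rnDeriv Q) ω :=
  if_neg (not_or.2 h)

lemma law_apply (α : ℝ) (Q P : Measure 𝒵) [IsProbabilityMeasure Q] {S : Set ((ℕ → 𝒵) × ℕ)}
    (hS : MeasurableSet S) :
    law α Q P S = ∫⁻ ω, ∑' k, indexProb α Q P ω.1 ω.2 k * S.indicator 1 (ω.1, k)
      ∂(sourceLaw Q) := by
  have hmap : Measurable fun p : ((ℕ → 𝒵) × (ℕ → ℝ)) × ℕ => (p.1.1, p.2) := by fun_prop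
  rw [law, Measure.map_apply hmap hS, Measure.compProd_apply (hmap hS)]
  refine lintegral_congr fun ω => ?_
  change (Measure.sum fun k => indexProb α Q P ω.1 ω.2 k • Measure.dirac k) _ = _
  rw [Measure.sum_apply _ (measurable_prodMk_left (hmap hS))]
  refine tsum_congr fun k => ?_
  rw [Measure.smul_apply, smul_eq_mul,
    Measure.dirac_apply' _ (measurable_prodMk_left (hmap hS))]
  rfl

lemma law_add_lintegral_share_le {α : ℝ} (hα : 1 < α) (Q P P' : Measure 𝒵)
    [IsProbabilityMeasure Q] [IsProbabilityMeasure P] [IsProbabilityMeasure P'] (hP : P ≪ Q)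
    (hP' : P' ≪ Q) {m M : 𝒵 → ℝ≥0∞} {b : ℝ≥0∞} (hb : 1 ≤ b) (hb' : b ≠ ∞)
    (hmf : ∀ z, m z ≤ P.rnDeriv Q z) (hfM : ∀ z, P.rnDeriv Q z ≤ M z)
    (hmg : ∀ z, m z ≤ b * P'.rnDeriv Q z) (hgM : ∀ z, b⁻¹ * P'.rnDeriv Q z ≤ M z)
    {S : Set ((ℕ → 𝒵) × ℕ)} (hS : MeasurableSet S) :
    law α Q P S + ∫⁻ ω, ∑' k, share α m M ω k ∂(sourceLaw Q)
      ≤ 1 + (b ^ α) ^ 2 * law α Q P' S := by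
  have hα0 : 0 < α := one_pos.trans hα
  have hae (R : Measure 𝒵) [IsProbabilityMeasure R] (hR : R ≪ Q) :=
    ae_totalWeight_ne hα (Q := Q) (Measure.measurable_rnDeriv R Q)
      (by simp [Measure.lintegral_rnDeriv hR]) (by simp [Measure.lintegral_rnDeriv hR])
  have hind (k : ℕ) : Measurable fun ω : (ℕ → 𝒵) × (ℕ → ℝ) =>
      S.indicator (1 : (ℕ → 𝒵) × ℕ → ℝ≥0∞) (ω.1, k) :=
    (measurable_one.indicator hS).comp (by fun_prop)
  have hterm (R : Measure 𝒵) (k : ℕ) : Measurable fun ω : (ℕ → 𝒵) × (ℕ → ℝ) =>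
      indexProb α Q R ω.1 ω.2 k * S.indicator 1 (ω.1, k) :=
    (measurable_indexProb α Q R k).mul (hind k)
  rw [law_apply α Q P hS, law_apply α Q P' hS,
    ← lintegral_const_mul _ (Measurable.tsum fun k => hterm P' k),
    ← lintegral_add_left (Measurable.tsum fun k => hterm P k)]
  have hone : ∫⁻ _, (1 : ℝ≥0∞) ∂(sourceLaw Q) = 1 := by simp
  conv_rhs => rw [← hone]
  rw [← lintegral_add_left measurable_const]
  refine lintegral_mono_ae ?_
  filter_upwards [ae_pos_time Q, hae P hP, hae P' hP',
    ae_forall_sample (Measure.rnDeriv_ne_top P Q),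
    ae_forall_sample (Measure.rnDeriv_ne_top P' Q)] with ω hω hf hg hft hgt
  rw [← tsum_indexProb α Q P ω.1 ω.2, ← ENNReal.tsum_mul_left, ← ENNReal.tsum_add,
    ← ENNReal.tsum_add]
  refine ENNReal.tsum_le_tsum fun k => ?_
  have h1 := share_le hα0 hmf hfM hω (hft k)
  have h2 := share_le_mul hα0 hb hb' hmg hgM hω (hgt k)
  rw [← indexProb_eq hf] at h1
  rw [← indexProb_eq hg] at h2
  -- Inside the event the share is charged to the second law; outside it, to the unused selection
  -- probability of the first.
  by_cases hk : (ω.1, k) ∈ S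
  · simpa [hk] using add_le_add_right h2 _
  · simpa [hk] using h1

/-! ### Privacy in terms of densities -/

/-- The mass of `P` that remains below the density of `b • P'` is at least `1 - δ`. -/
lemma one_le_lintegral_min_rnDeriv_add {Q P P' : Measure 𝒵} [IsProbabilityMeasure Q]
    [IsProbabilityMeasure P] [IsProbabilityMeasure P'] (hP : P ≪ Q) (hP' : P' ≪ Q) {b d : ℝ≥0∞}
    (h : ∀ S, MeasurableSet S → P S ≤ b * P' S + d) :
    1 ≤ ∫⁻ z, min (P.rnDeriv Q z) (b * P'.rnDeriv Q z) ∂Q + d := by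
  have hf := Measure.measurable_rnDeriv P Q
  have hg := Measure.measurable_rnDeriv P' Q
  set S : Set 𝒵 := {z | b * P'.rnDeriv Q z < P.rnDeriv Q z} with hSdef
  have hS : MeasurableSet S := measurableSet_lt (hg.const_mul b) hf
  have h1 : ∫⁻ z in S, min (P.rnDeriv Q z) (b * P'.rnDeriv Q z) ∂Q = b * P' S := by
    rw [setLIntegral_congr_fun hS fun z hz => min_eq_right (le_of_lt hz),
      lintegral_const_mul _ hg, Measure.setLIntegral_rnDeriv hP']
  have h2 : ∫⁻ z in Sᶜ, min (P.rnDeriv Q z) (b * P'.rnDeriv Q z) ∂Q = P Sᶜ := by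
    rw [setLIntegral_congr_fun hS.compl fun z hz => min_eq_left (not_lt.1 hz),
      Measure.setLIntegral_rnDeriv hP]
  rw [← lintegral_add_compl _ hS, h1, h2, ← measure_univ (μ := P), ← measure_add_measure_compl hS,
    add_right_comm]
  gcongr
  exact h S hS

/-- The maximum exceeds the density of `P` only on `S`, with excess mass `b⁻¹ * P' S - P S ≤ b⁻¹ * d
≤ d`. -/
lemma lintegral_max_rnDeriv_le {Q P P' : Measure 𝒵} [IsProbabilityMeasure Q]
    [IsProbabilityMeasure P] [IsProbabilityMeasure P'] (hP : P ≪ Q) (hP' : P' ≪ Q) {b d : ℝ≥0∞}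
    (hb : 1 ≤ b) (hb' : b ≠ ∞) (h : ∀ S, MeasurableSet S → P' S ≤ b * P S + d) :
    ∫⁻ z, max (P.rnDeriv Q z) (b⁻¹ * P'.rnDeriv Q z) ∂Q ≤ 1 + d := by
  have hf := Measure.measurable_rnDeriv P Q
  have hg := Measure.measurable_rnDeriv P' Q
  have hb0 : b ≠ 0 := (one_pos.trans_le hb).ne'
  set S : Set 𝒵 := {z | P.rnDeriv Q z < b⁻¹ * P'.rnDeriv Q z} with hSdef
  have hS : MeasurableSet S := measurableSet_lt hf (hg.const_mul _)
  have h1 : ∫⁻ z in S, max (P.rnDeriv Q z) (b⁻¹ * P'.rnDeriv Q z) ∂Q = b⁻¹ * P' S := by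
    rw [setLIntegral_congr_fun hS fun z hz => max_eq_right (le_of_lt hz),
      lintegral_const_mul _ hg, Measure.setLIntegral_rnDeriv hP']
  have h2 : ∫⁻ z in Sᶜ, max (P.rnDeriv Q z) (b⁻¹ * P'.rnDeriv Q z) ∂Q = P Sᶜ := by
    rw [setLIntegral_congr_fun hS.compl fun z hz => max_eq_left (not_lt.1 hz),
      Measure.setLIntegral_rnDeriv hP]
  rw [← lintegral_add_compl _ hS, h1, h2, ← measure_univ (μ := P), ← measure_add_measure_compl hS,
    add_right_comm]
  gcongr
  calc b⁻¹ * P' S ≤ b⁻¹ * (b * P S + d) := by gcongr; exact h S hS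
    _ = P S + b⁻¹ * d := by
      rw [mul_add, ← mul_assoc, ENNReal.inv_mul_cancel hb0 hb', one_mul]
    _ ≤ P S + d := by
      gcongr
      exact mul_le_of_le_one_left bot_le (ENNReal.inv_le_one.2 hb)

end PPR

lemma IsDP.nonneg {𝒳 𝒴 : Type*} [MeasurableSpace 𝒴] {N : 𝒳 → 𝒳 → Prop} {M : 𝒳 → Measure 𝒴}
    {ε δ : ℝ} (h : IsDP N M ε δ) {x x' : 𝒳} (hx : N x x') : 0 ≤ δ := by
  simpa using h x x' hx ∅ .empty

lemma IsDP.measure_le {𝒳 𝒴 : Type*} [MeasurableSpace 𝒴] {N : 𝒳 → 𝒳 → Prop} {M : 𝒳 → Measure 𝒴}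
    [∀ x, IsProbabilityMeasure (M x)] {ε δ : ℝ} (h : IsDP N M ε δ) {x x' : 𝒳} (hx : N x x')
    {S : Set 𝒴} (hS : MeasurableSet S) :
    M x S ≤ ENNReal.ofReal (Real.exp ε) * M x' S + ENNReal.ofReal δ := by
  have h1 := ENNReal.ofReal_le_ofReal (h x x' hx S hS)
  rwa [ENNReal.ofReal_add (mul_nonneg (Real.exp_pos ε).le measureReal_nonneg) (h.nonneg hx),
    ENNReal.ofReal_mul (Real.exp_pos ε).le, ofReal_measureReal, ofReal_measureReal] at h1

end

theorem mainTheorem10 {𝒳 𝒵 : Type*} [MeasurableSpace 𝒵]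
    (N : 𝒳 → 𝒳 → Prop) (hN : ∀ x x', N x x' → N x' x)
    (P : 𝒳 → Measure 𝒵) (hP : ∀ x, IsProbabilityMeasure (P x))
    (Q : Measure 𝒵) [IsProbabilityMeasure Q] (hPQ : ∀ x, P x ≪ Q)
    (ε δ α : ℝ) (hε : 0 ≤ ε) (hα : 1 < α)
    (hDP : IsDP N P ε δ) :
    IsDP N (fun x => PPR.law α Q (P x)) (2 * α * ε) (2 * δ) := by
  intro x x' hx S hS
  -- The empty event forces this, so `ENNReal.ofReal δ` does not truncate.
  have hδ : 0 ≤ δ := hDP.nonneg hx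
  set f := (P x).rnDeriv Q with hfdef
  set g := (P x').rnDeriv Q with hgdef
  have hf : Measurable f := Measure.measurable_rnDeriv _ _
  have hg : Measurable g := Measure.measurable_rnDeriv _ _
  set b : ℝ≥0∞ := ENNReal.ofReal (Real.exp ε) with hbdef
  have hb : 1 ≤ b := ENNReal.one_le_ofReal.2 (Real.one_le_exp hε)
  have hb' : b ≠ ∞ := ENNReal.ofReal_ne_top
  set m : 𝒵 → ℝ≥0∞ := fun z => min (f z) (b * g z) with hmdef
  set M : 𝒵 → ℝ≥0∞ := fun z => max (f z) (b⁻¹ * g z) with hMdef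
  have hm : Measurable m := by fun_prop
  have hM : Measurable M := by fun_prop
  have hfint : ∫⁻ z, f z ∂Q = 1 := by simp [hfdef, Measure.lintegral_rnDeriv (hPQ x)]
  have hmM := PPR.law_add_lintegral_share_le hα Q (P x) (P x') (hPQ x) (hPQ x') hb hb'
    (fun z => min_le_left _ _) (fun z => le_max_left _ _) (fun z => min_le_right _ _)
    (fun z => le_max_right _ _) hS
  have hmle : 1 ≤ ∫⁻ z, m z ∂Q + ENNReal.ofReal δ :=
    PPR.one_le_lintegral_min_rnDeriv_add (hPQ x) (hPQ x') fun T hT => hDP.measure_le hx hT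
  -- The bound on the maximum needs privacy from `x'` to `x`; this is where symmetry of the neighbor
  -- relation enters.
  have hMle : ∫⁻ z, M z ∂Q ≤ 1 + ENNReal.ofReal δ :=
    PPR.lintegral_max_rnDeriv_le (hPQ x) (hPQ x') hb hb'
      fun T hT => hDP.measure_le (hN x x' hx) hT
  have hM1 : 1 ≤ ∫⁻ z, M z ∂Q := hfint ▸ lintegral_mono fun z => le_max_left _ _
  have hm1 : ∫⁻ z, m z ∂Q ≤ 1 := hfint ▸ lintegral_mono fun z => min_le_left _ _
  have hMtop : ∫⁻ z, M z ∂Q ≠ ∞ := ne_top_of_le_ne_top (by simp) hMle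
  have hkey := PPR.mul_lintegral_tsum_share hα hm hM (ne_top_of_le_ne_top (by simp) hm1)
    (one_pos.trans_le hM1).ne' hMtop
  set q := ∫⁻ ω, ∑' k, PPR.share α m M ω k ∂(PPR.sourceLaw Q)
  have hc : (b ^ α) ^ 2 = ENNReal.ofReal (Real.exp (2 * α * ε)) := by
    rw [hbdef, ENNReal.ofReal_rpow_of_pos (Real.exp_pos _), ← Real.exp_mul,
      ← ENNReal.ofReal_pow (Real.exp_pos _).le, ← Real.exp_nat_mul]
    congr 2
    push_cast
    ring
  have hq1 : q ≤ 1 := by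
    calc q = 1 * q := (one_mul q).symm
      _ ≤ (∫⁻ z, M z ∂Q) * q := by gcongr
      _ ≤ 1 := hkey.trans_le hm1
  -- One `δ` is the mass lost by `m`; the other is the extra mass of `M`, multiplied by `q ≤ 1`.
  have hq : 1 ≤ q + 2 * ENNReal.ofReal δ := by
    calc 1 ≤ (∫⁻ z, M z ∂Q) * q + ENNReal.ofReal δ := by rwa [hkey]
      _ ≤ (1 + ENNReal.ofReal δ) * q + ENNReal.ofReal δ := by gcongr
      _ = q + ENNReal.ofReal δ * q + ENNReal.ofReal δ := by ring
      _ ≤ q + ENNReal.ofReal δ * 1 + ENNReal.ofReal δ := by gcongr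
      _ = q + 2 * ENNReal.ofReal δ := by ring
  have hfin : PPR.law α Q (P x) S ≤
      ENNReal.ofReal (Real.exp (2 * α * ε)) * PPR.law α Q (P x') S + 2 * ENNReal.ofReal δ := by
    refine (ENNReal.add_le_add_iff_right (ne_top_of_le_ne_top ENNReal.one_ne_top hq1)).1 ?_
    calc PPR.law α Q (P x) S + q ≤ 1 + (b ^ α) ^ 2 * PPR.law α Q (P x') S := hmM
      _ ≤ q + 2 * ENNReal.ofReal δ + (b ^ α) ^ 2 * PPR.law α Q (P x') S := by gcongr
      _ = _ := by
        rw [hc]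
        ring
  have htop : ENNReal.ofReal (Real.exp (2 * α * ε)) * PPR.law α Q (P x') S ≠ ∞ :=
    ENNReal.mul_ne_top ENNReal.ofReal_ne_top (measure_ne_top _ _)
  have htop' : 2 * ENNReal.ofReal δ ≠ ∞ := ENNReal.mul_ne_top (by simp) ENNReal.ofReal_ne_top
  have hreal := ENNReal.toReal_mono (ENNReal.add_ne_top.2 ⟨htop, htop'⟩) hfin
  rw [ENNReal.toReal_add htop htop', ENNReal.toReal_mul, ENNReal.toReal_mul,
    ENNReal.toReal_ofReal (Real.exp_pos _).le, ENNReal.toReal_ofReal hδ,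
    ENNReal.toReal_ofNat] at hreal
  exact hreal
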